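/- Let $\Sigma\subset\mathbb{R}^2$ be open and let $f\colon\Sigma\to\mathbb{R}^3$ be a front, i.e. $f$ is $C^\infty$ and there is a $C^\infty$ map $\nu\colon\Sigma\to\mathbb{S}^2$ (unit normal) with $\langle df(X),\nu\rangle=0$ for all tangent vectors $X$, such that $(f,\nu)$ is an immersion. (Without the immersion condition $f$ is called a frontal.) Put $\lambda=\det(f_u,f_v,\nu)$. A singular point $p$ of a frontal (a point where it is not an immersion) is non-degenerate if $d\lambda(p)\neq0$. It is then of the second kind if $\gamma'(0)$ and $\eta(p)$ are linearly dependent, where $\gamma$ is a regular curve with $\gamma(0)=p$ and $\lambda\circ\gamma=0$, and $\eta$ is a never-vanishing smooth vector field near $p$ with $df(\eta)=0$ at all singular points of $f$. Let $p\in\Sigma$ be a singular point of the second kind of $f$. Near $p$, at regular points, one principal curvature of $f$ is bounded and the other, $\tilde\kappa$, is unbounded (it is the one with the larger absolute value). Let $\hat\rho=1/\tilde\kappa$ at regular points and $\hat\rho=0$ at singular points, and let $\widehat{C}=f+\hat\rho\,\nu$ be the focal surface associated to $\tilde\kappa$. A real function $\varphi$ defined on the set of regular points of a frontal is called *rationally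 bounded* at $p$ if, for all but finitely many $\theta\in[0,2\pi)$, the points $p+r(\cos\theta,\sin\theta)$ with $r>0$ small are regular and the finite limit $\lim_{r\to+0}\varphi(p+r(\cos\theta,\sin\theta))$ exists; it is *rationally continuous* at $p$ if moreover this limit does not depend on $\theta$. Suppose that the Gaussian curvature $K$ of $f$ is either bounded on the set of regular points in some neighborhood of $p$, or rationally continuous at $p$. Then $\widehat{C}$ is a frontal on a neighborhood of $p$, and if $\widehat{C}$ has a non-degenerate singularity at $p$ (with respect to any smooth unit normal of $\widehat{C}$ near $p$), then the Gaussian curvature $K^{\widehat{C}}$ of $\widehat{C}$ is rationally bounded at $p$. -/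

import Mathlib

open Filter Topology
open scoped ContDiff

noncomputable section

namespace FrontGeometry

/-- The source plane with coordinates `(u, v)`. -/
abbrev Plane : Type := ℝ × ℝ

/-- Euclidean 3-space with its canonical inner product. -/
abbrev Space : Type := EuclideanSpace ℝ (Fin 3)

/-- The partial derivative `∂f/∂u`. -/
def partialU (f : Plane → Space) (q : Plane) : Space := fderiv ℝ f q (1, 0)

/-- The partial derivative `∂f/∂v`. -/
def partialV (f : Plane → Space) (q : Plane) : Space := fderiv ℝ f q (0, 1)

/-- The determinant of three vectors of Euclidean 3-space. -/
def det3 (a b c : Space) : ℝ :=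
  Matrix.det !![a 0, a 1, a 2; b 0, b 1, b 2; c 0, c 1, c 2]

/-- `f` is a frontal on the open set `S`, with smooth unit normal vector field `ν`. -/
structure IsFrontal (S : Set Plane) (f ν : Plane → Space) : Prop where
  isOpen : IsOpen S
  smooth : ContDiffOn ℝ ∞ f S
  smooth_normal : ContDiffOn ℝ ∞ ν S
  unit_normal : ∀ q ∈ S, ‖ν q‖ = 1
  orthogonal : ∀ q ∈ S, ∀ X : Plane, inner ℝ (fderiv ℝ f q X) (ν q) = 0

/-- A front is a frontal for which the pair `(f, ν)` is an immersion. -/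
structure IsFront (S : Set Plane) (f ν : Plane → Space) : Prop extends IsFrontal S f ν where
  immersion : ∀ q ∈ S, Function.Injective (fun X : Plane => (fderiv ℝ f q X, fderiv ℝ ν q X))

/-- `q` is a singular point of `f`: `f` is not an immersion at `q`. -/
def IsSingularPoint (f : Plane → Space) (q : Plane) : Prop :=
  ¬ Function.Injective (fderiv ℝ f q)

/-- The set of regular points of `f` in `S`. -/
def regularSet (S : Set Plane) (f : Plane → Space) : Set Plane :=
  {q | q ∈ S ∧ ¬ IsSingularPoint f q}

/-- The signed area density function `det (f_u, f_v, ν)`. -/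
def areaDensity (f ν : Plane → Space) (q : Plane) : ℝ :=
  det3 (partialU f q) (partialV f q) (ν q)

/-- Non-degenerate singular points: the differential of the signed area density is not zero. -/
def IsNondegenerateSingularPoint (f ν : Plane → Space) (p : Plane) : Prop :=
  IsSingularPoint f p ∧ fderiv ℝ (areaDensity f ν) p ≠ 0

/-- `γ : (-ε, ε) → U` is a regular parametrization of singular points of `f` with `γ 0 = p`. -/
structure IsSingularCurve (U : Set Plane) (f ν : Plane → Space) (p : Plane) (ε : ℝ)
    (γ : ℝ → Plane) : Prop where
  pos : 0 < ε
  smooth : ContDiffOn ℝ ∞ γ (Set.Ioo (-ε) ε)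
  mapsTo : Set.MapsTo γ (Set.Ioo (-ε) ε) U
  base : γ 0 = p
  regular : ∀ t ∈ Set.Ioo (-ε) ε, deriv γ t ≠ 0
  singular : ∀ t ∈ Set.Ioo (-ε) ε, areaDensity f ν (γ t) = 0

/-- `η` is a never-vanishing vector field on `U` with `df(η) = 0` at the singular points of `f`. -/
structure IsNullVectorField (U : Set Plane) (f : Plane → Space) (η : Plane → Plane) : Prop where
  smooth : ContDiffOn ℝ ∞ η U
  ne_zero : ∀ q ∈ U, η q ≠ 0
  null : ∀ q ∈ U, IsSingularPoint f q → fderiv ℝ f q (η q) = 0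

/-- `p` is a singular point of the second kind: it is non-degenerate, and the velocity of the
singular curve and the null vector field are linearly dependent at `p`.  At a non-degenerate
singular point a singular curve and a null vector field exist, and their directions at `p` do not
depend on the choice. -/
def IsSecondKind (S : Set Plane) (f ν : Plane → Space) (p : Plane) : Prop :=
  IsNondegenerateSingularPoint f ν p ∧
    ∃ U : Set Plane, IsOpen U ∧ p ∈ U ∧ U ⊆ S ∧
      ∃ (ε : ℝ) (γ : ℝ → Plane) (η : Plane → Plane),
        IsSingularCurve U f ν p ε γ ∧ IsNullVectorField U f η ∧
          ¬ LinearIndependent ℝ ![deriv γ 0, η p]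

/-- The matrix of the first fundamental form. -/
def firstForm (f : Plane → Space) (q : Plane) : Matrix (Fin 2) (Fin 2) ℝ :=
  !![inner ℝ (partialU f q) (partialU f q), inner ℝ (partialU f q) (partialV f q);
     inner ℝ (partialU f q) (partialV f q), inner ℝ (partialV f q) (partialV f q)]

/-- The matrix of the second fundamental form. -/
def secondForm (f ν : Plane → Space) (q : Plane) : Matrix (Fin 2) (Fin 2) ℝ :=
  !![-inner ℝ (partialU f q) (partialU ν q), -inner ℝ (partialU f q) (partialV ν q);
     -inner ℝ (partialV f q) (partialU ν q), -inner ℝ (partialV f q) (partialV ν q)]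

/-- The Gaussian curvature `det II / det I`; it is meaningful at regular points only. -/
def gaussianCurvature (f ν : Plane → Space) (q : Plane) : ℝ :=
  (secondForm f ν q).det / (firstForm f q).det

/-- The mean curvature `(G L - 2 F M + E N) / (2 (E G - F ^ 2))`; it is meaningful at regular
points only. -/
def meanCurvature (f ν : Plane → Space) (q : Plane) : ℝ :=
  (firstForm f q 1 1 * secondForm f ν q 0 0 - 2 * firstForm f q 0 1 * secondForm f ν q 0 1
      + firstForm f q 0 0 * secondForm f ν q 1 1) / (2 * (firstForm f q).det)

/-- Of the two principal curvatures `H ± √(H² - K)` at a regular point, the one with the larger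
absolute value.  At the regular points close to a non-degenerate singular point of a front, `|H|`
is large, this one is the unbounded principal curvature, and the other one is the bounded one. -/
def unboundedPrincipalCurvature (f ν : Plane → Space) (q : Plane) : ℝ :=
  if 0 ≤ meanCurvature f ν q then
    meanCurvature f ν q + √(meanCurvature f ν q ^ 2 - gaussianCurvature f ν q)
  else
    meanCurvature f ν q - √(meanCurvature f ν q ^ 2 - gaussianCurvature f ν q)

open Classical in
/-- The curvature radius of the unbounded principal curvature, extended by its limit `0` to the
singular points. -/
def unboundedCurvatureRadius (f ν : Plane → Space) (q : Plane) : ℝ :=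
  if IsSingularPoint f q then 0 else 1 / unboundedPrincipalCurvature f ν q

/-- The focal surface associated to the unbounded principal curvature. -/
def focalSurface (f ν : Plane → Space) (q : Plane) : Space :=
  f q + unboundedCurvatureRadius f ν q • ν q

/-- The point with polar coordinates `(r, θ)` centered at `p`. -/
def polarPoint (p : Plane) (r θ : ℝ) : Plane :=
  p + r • (Real.cos θ, Real.sin θ)

/-- `φ` is bounded near `p` on the part of its domain `D` close to `p`. -/
def IsBoundedNear (D : Set Plane) (φ : Plane → ℝ) (p : Plane) : Prop :=
  ∃ W ∈ 𝓝 p, ∃ B : ℝ, ∀ q ∈ W ∩ D, |φ q| ≤ B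

/-- A function `φ` with domain `D` is rationally bounded at `p` if, for all but finitely many
directions `θ`, the points of the ray from `p` in the direction `θ` that are close to `p` lie in `D`
and `φ` has a finite limit at `p` along that ray. -/
def IsRationallyBounded (D : Set Plane) (φ : Plane → ℝ) (p : Plane) : Prop :=
  ∃ T : Set ℝ, T.Finite ∧ ∀ θ ∈ Set.Ico 0 (2 * Real.pi) \ T,
    (∀ᶠ r in 𝓝[>] (0 : ℝ), polarPoint p r θ ∈ D) ∧
      ∃ c : ℝ, Tendsto (fun r => φ (polarPoint p r θ)) (𝓝[>] 0) (𝓝 c)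

/-- A function `φ` with domain `D` is rationally continuous at `p` if it is rationally bounded at
`p` and the limits along the rays do not depend on the direction. -/
def IsRationallyContinuous (D : Set Plane) (φ : Plane → ℝ) (p : Plane) : Prop :=
  ∃ c : ℝ, ∃ T : Set ℝ, T.Finite ∧ ∀ θ ∈ Set.Ico 0 (2 * Real.pi) \ T,
    (∀ᶠ r in 𝓝[>] (0 : ℝ), polarPoint p r θ ∈ D) ∧
      Tendsto (fun r => φ (polarPoint p r θ)) (𝓝[>] 0) (𝓝 c)

end FrontGeometry

end

/-! Write `λ = det(f_u, f_v, ν)`, `μ = det(ν_u, ν_v, ν)` and let `h` be the mixed density. They are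
smooth across singular points, and `K = μ/λ`, `H = h/λ`. The curvature radii solve `μρ² - 2hρ + λ =
0`. At `p` one has `λ = 0`, while `h ≠ 0` because `f` is a front, so the small root is smooth near
`p` and equals the radius of the unbounded curvature. The same equation makes all vectors `df(X) + ρ
dν(X)` parallel to one direction `A`. Since `dĈ(X)` is such a vector plus a multiple of `ν`, the
cross product `A × ν` is a normal of `Ĉ`. Either hypothesis on `K` gives `|μ| ≤ B|λ|` along almost
all rays. Hence `μ(p) = 0`, and `dμ(p)` vanishes on `ker dλ(p)`, which contains the null vector `η`
because the singularity is of the second kind (`IsFrontal.areaDensity_normal_eq_zero`). The main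
step, `IsFront.areaDensity_focalNormal_eq_zero`, deduces that the normal `n` of `Ĉ` also has a
singular differential at `p`: a vector `ξ` with `dν(ξ) = 0` satisfies `dn(ξ) = 0`. The curvature of
`Ĉ` is then a quotient of two functions vanishing at `p`. The denominator has nonzero differential
there, so along almost every ray the quotient tends to a quotient of linear forms. -/

namespace FrontGeometry

/-! ### Determinants and inner products in the plane and in 3-space. -/

theorem inner_space_eq (a b : Space) :
    inner ℝ a b = a 0 * b 0 + a 1 * b 1 + a 2 * b 2 := by
  simp [PiLp.inner_apply, Fin.sum_univ_three]
  ring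

theorem det3_eq (a b c : Space) :
    det3 a b c = a 0 * (b 1 * c 2 - b 2 * c 1) - a 1 * (b 0 * c 2 - b 2 * c 0)
      + a 2 * (b 0 * c 1 - b 1 * c 0) := by
  simp [det3, Matrix.det_fin_three]
  ring

/-- The product of two determinants is the determinant of the matrix of inner products. -/
theorem det3_mul_det3 (a b c x y z : Space) :
    det3 a b c * det3 x y z =
      inner ℝ a x * (inner ℝ b y * inner ℝ c z - inner ℝ b z * inner ℝ c y)
      - inner ℝ a y * (inner ℝ b x * inner ℝ c z - inner ℝ b z * inner ℝ c x)
      + inner ℝ a z * (inner ℝ b x * inner ℝ c y - inner ℝ b y * inner ℝ c x) := by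
  simp only [det3_eq, inner_space_eq]
  ring

theorem inner_unit_self {c : Space} (hc : ‖c‖ = 1) : inner ℝ c c = 1 := by
  rw [real_inner_self_eq_norm_sq, hc]; norm_num

/-- A vector orthogonal to three linearly independent vectors vanishes. -/
theorem eq_zero_of_inner_eq_zero {a b c w : Space} (h : det3 a b c ≠ 0)
    (ha : inner ℝ w a = 0) (hb : inner ℝ w b = 0) (hc : inner ℝ w c = 0) : w = 0 := by
  rw [inner_space_eq] at ha hb hc
  rw [det3_eq] at h
  ext i
  have h0 : w 0 = 0 := by
    apply (mul_eq_zero_iff_left h).1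
    linear_combination (b 1 * c 2 - b 2 * c 1) * ha - (a 1 * c 2 - a 2 * c 1) * hb
      + (a 1 * b 2 - a 2 * b 1) * hc
  have h1 : w 1 = 0 := by
    apply (mul_eq_zero_iff_left h).1
    linear_combination -(b 0 * c 2 - b 2 * c 0) * ha + (a 0 * c 2 - a 2 * c 0) * hb
      - (a 0 * b 2 - a 2 * b 0) * hc
  have h2 : w 2 = 0 := by
    apply (mul_eq_zero_iff_left h).1
    linear_combination (b 0 * c 1 - b 1 * c 0) * ha - (a 0 * c 1 - a 1 * c 0) * hb
      + (a 0 * b 1 - a 1 * b 0) * hc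
  fin_cases i <;> simpa

/-- The determinant of two vectors of the plane. -/
def det2 (X Y : Plane) : ℝ := X.1 * Y.2 - X.2 * Y.1

theorem exists_smul_of_det2_eq_zero {X Y : Plane} (hX : X ≠ 0) (h : det2 X Y = 0) :
    ∃ t : ℝ, Y = t • X := by
  obtain ⟨x, y⟩ := X
  obtain ⟨z, w⟩ := Y
  simp only [det2] at h
  by_cases hx : x = 0
  · have hy : y ≠ 0 := by rintro rfl; exact hX (by simp [hx])
    refine ⟨w / y, ?_⟩
    have : z = 0 := by
      subst hx
      apply (mul_eq_zero_iff_left hy).1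
      linarith
    ext <;> simp [this, hx]
    field_simp
  · refine ⟨z / x, ?_⟩
    ext <;> simp
    · field_simp
    · field_simp
      linarith

theorem apply_plane {E : Type*} [NormedAddCommGroup E] [NormedSpace ℝ E] (L : Plane →L[ℝ] E)
    (X : Plane) : L X = X.1 • L (1, 0) + X.2 • L (0, 1) := by
  rw [← map_smul, ← map_smul, ← map_add]
  congr 1
  ext <;> simp

/-- Lets the area densities be computed in adapted directions instead of the coordinate ones. -/
theorem det3_apply_apply (L : Plane →L[ℝ] Space) (c : Space) (X Y : Plane) :
    det3 (L X) (L Y) c = det2 X Y * det3 (L (1, 0)) (L (0, 1)) c := by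
  rw [apply_plane L X, apply_plane L Y]
  simp only [det3_eq, det2, PiLp.add_apply, PiLp.smul_apply, smul_eq_mul]
  ring

/-- The polarization of `det3_apply_apply` in `L`, needed for the mixed density. -/
theorem det3_apply_apply_add (L M : Plane →L[ℝ] Space) (c : Space) (X Y : Plane) :
    det3 (L X) (M Y) c + det3 (M X) (L Y) c =
      det2 X Y * (det3 (L (1, 0)) (M (0, 1)) c + det3 (M (1, 0)) (L (0, 1)) c) := by
  rw [apply_plane L X, apply_plane L Y, apply_plane M X, apply_plane M Y]
  simp only [det3_eq, det2, PiLp.add_apply, PiLp.smul_apply, smul_eq_mul]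
  ring

/-- A linear map from the plane to the orthogonal complement of a unit vector `c` is injective if
and only if its determinant relative to `c` does not vanish. -/
theorem not_injective_iff_det3_eq_zero (L : Plane →L[ℝ] Space) {c : Space} (hc : ‖c‖ = 1)
    (hL : ∀ X, inner ℝ (L X) c = 0) :
    ¬ Function.Injective L ↔ det3 (L (1, 0)) (L (0, 1)) c = 0 := by
  rw [injective_iff_map_eq_zero]
  push Not
  constructor
  · rintro ⟨X, h0, hX⟩
    have h1 : X.1 * det3 (L (1, 0)) (L (0, 1)) c = 0 := by
      have := det3_apply_apply L c X (0, 1)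
      rw [h0] at this
      simpa [det2, det3_eq] using this.symm
    have h2 : X.2 * det3 (L (1, 0)) (L (0, 1)) c = 0 := by
      have := det3_apply_apply L c X (1, 0)
      rw [h0] at this
      simpa [det2, det3_eq] using this.symm
    by_contra h
    exact hX (Prod.ext ((mul_eq_zero_iff_right h).1 h1) ((mul_eq_zero_iff_right h).1 h2))
  · intro h
    have hg := det3_mul_det3 (L (1, 0)) (L (0, 1)) c (L (1, 0)) (L (0, 1)) c
    rw [h, hL, hL, inner_unit_self hc, real_inner_comm (L (1, 0)) (L (0, 1))] at hg
    by_cases hG : L (0, 1) = 0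
    · exact ⟨(0, 1), hG, by simp⟩
    -- With `E`, `F`, `G` the Gram entries, the witness is `(G, -F)`: its image has squared norm
    -- `G(EG - F²)`, and `EG - F²` is the squared determinant.
    refine ⟨(inner ℝ (L (0, 1)) (L (0, 1)), -inner ℝ (L (1, 0)) (L (0, 1))), ?_, ?_⟩
    · rw [apply_plane, ← inner_self_eq_zero (𝕜 := ℝ)]
      simp only [inner_add_left, inner_add_right, real_inner_smul_left, real_inner_smul_right]
      rw [real_inner_comm (L (1, 0)) (L (0, 1))]
      linear_combination -inner ℝ (L (0, 1)) (L (0, 1)) * hg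
    · intro h
      exact hG (inner_self_eq_zero.1 (Prod.ext_iff.1 h).1)

/-! ### Smoothness and derivatives of determinants and cross products. -/

theorem contDiffAt_coord {g : Plane → Space} {q : Plane} {k : WithTop ℕ∞}
    (hg : ContDiffAt ℝ k g q) (i : Fin 3) : ContDiffAt ℝ k (fun x => g x i) q :=
  (contDiffAt_euclidean.1 hg) i

theorem contDiffAt_det3 {a b c : Plane → Space} {q : Plane} {k : WithTop ℕ∞}
    (ha : ContDiffAt ℝ k a q) (hb : ContDiffAt ℝ k b q) (hc : ContDiffAt ℝ k c q) :
    ContDiffAt ℝ k (fun x => det3 (a x) (b x) (c x)) q := by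
  simp only [det3_eq]
  have ha' := contDiffAt_coord ha
  have hb' := contDiffAt_coord hb
  have hc' := contDiffAt_coord hc
  exact (((ha' 0).mul (((hb' 1).mul (hc' 2)).sub ((hb' 2).mul (hc' 1)))).sub
    ((ha' 1).mul (((hb' 0).mul (hc' 2)).sub ((hb' 2).mul (hc' 0))))).add
    ((ha' 2).mul (((hb' 0).mul (hc' 1)).sub ((hb' 1).mul (hc' 0))))

theorem hasFDerivAt_coord {g : Plane → Space} {q : Plane} (hg : DifferentiableAt ℝ g q)
    (i : Fin 3) : HasFDerivAt (fun x => g x i)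
      ((EuclideanSpace.proj i : Space →L[ℝ] ℝ).comp (fderiv ℝ g q)) q :=
  (EuclideanSpace.proj i : Space →L[ℝ] ℝ).hasFDerivAt.comp q hg.hasFDerivAt

theorem fderiv_det3 {a b c : Plane → Space} {q : Plane} (ha : DifferentiableAt ℝ a q)
    (hb : DifferentiableAt ℝ b q) (hc : DifferentiableAt ℝ c q) (X : Plane) :
    fderiv ℝ (fun x => det3 (a x) (b x) (c x)) q X =
      det3 (fderiv ℝ a q X) (b q) (c q) + det3 (a q) (fderiv ℝ b q X) (c q)
        + det3 (a q) (b q) (fderiv ℝ c q X) := by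
  simp only [det3_eq]
  have ha' := hasFDerivAt_coord ha
  have hb' := hasFDerivAt_coord hb
  have hc' := hasFDerivAt_coord hc
  have := (((ha' 0).mul (((hb' 1).mul (hc' 2)).sub ((hb' 2).mul (hc' 1)))).sub
    ((ha' 1).mul (((hb' 0).mul (hc' 2)).sub ((hb' 2).mul (hc' 0))))).add
    ((ha' 2).mul (((hb' 0).mul (hc' 1)).sub ((hb' 1).mul (hc' 0))))
  have h2 := this.fderiv
  simp only [Pi.mul_def, Pi.sub_def, Pi.add_def] at h2
  rw [h2]
  simp
  ring

theorem contDiffAt_fderiv_apply {E : Type*} [NormedAddCommGroup E] [NormedSpace ℝ E]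
    {g : Plane → E} {q : Plane} (hg : ContDiffAt ℝ ∞ g q) (X : Plane) :
    ContDiffAt ℝ ∞ (fun x => fderiv ℝ g x X) q :=
  (hg.fderiv_right (m := ∞) (by simp)).clm_apply contDiffAt_const

theorem fderiv_fderiv_comm {g : Plane → Space} {q : Plane} (hg : ContDiffAt ℝ ∞ g q)
    (X Y : Plane) : fderiv ℝ (fun x => fderiv ℝ g x X) q Y
      = fderiv ℝ (fun x => fderiv ℝ g x Y) q X := by
  have hd : DifferentiableAt ℝ (fderiv ℝ g) q :=
    (hg.fderiv_right (m := ∞) (by simp)).differentiableAt (by simp)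
  have key : ∀ Z W : Plane, fderiv ℝ (fun x => fderiv ℝ g x Z) q W
      = fderiv ℝ (fderiv ℝ g) q W Z := by
    intro Z W
    rw [fderiv_clm_apply hd (differentiableAt_const Z)]
    simp
  rw [key, key]
  exact hg.isSymmSndFDerivAt (by
    simpa using WithTop.coe_le_coe.2 (le_top : (2 : ℕ∞) ≤ ⊤)) Y X

/-- The cross product of Euclidean 3-space. -/
def cross3 (a b : Space) : Space :=
  !₂[a 1 * b 2 - a 2 * b 1, a 2 * b 0 - a 0 * b 2, a 0 * b 1 - a 1 * b 0]

theorem inner_cross3 (a b c : Space) : inner ℝ c (cross3 a b) = det3 a b c := by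
  rw [inner_space_eq, det3_eq]
  simp [cross3]
  ring

theorem inner_cross3_self (a b : Space) : inner ℝ (cross3 a b) (cross3 a b) =
    inner ℝ a a * inner ℝ b b - inner ℝ a b ^ 2 := by
  simp only [inner_space_eq]
  simp [cross3]
  ring

theorem contDiffAt_cross3 {a b : Plane → Space} {q : Plane} {k : WithTop ℕ∞}
    (ha : ContDiffAt ℝ k a q) (hb : ContDiffAt ℝ k b q) :
    ContDiffAt ℝ k (fun x => cross3 (a x) (b x)) q := by
  have ha' := contDiffAt_coord ha
  have hb' := contDiffAt_coord hb
  rw [contDiffAt_euclidean]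
  intro i
  fin_cases i
  · exact ((ha' 1).mul (hb' 2)).sub ((ha' 2).mul (hb' 1))
  · exact ((ha' 2).mul (hb' 0)).sub ((ha' 0).mul (hb' 2))
  · exact ((ha' 0).mul (hb' 1)).sub ((ha' 1).mul (hb' 0))

/-! ### Densities of a frontal and the curvatures as their quotients. -/

/-- The mixed area density `-(det (f_u, ν_v, ν) + det (ν_u, f_v, ν)) / 2`; it is the product of the
mean curvature and the signed area density. -/
noncomputable def meanDensity (f ν : Plane → Space) (q : Plane) : ℝ :=
  -(det3 (partialU f q) (partialV ν q) (ν q) + det3 (partialU ν q) (partialV f q) (ν q)) / 2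

theorem isSingularPoint_iff_of_inner_eq_zero {g c : Plane → Space} {q : Plane} (hc : ‖c q‖ = 1)
    (h : ∀ X, inner ℝ (fderiv ℝ g q X) (c q) = 0) :
    IsSingularPoint g q ↔ areaDensity g c q = 0 :=
  not_injective_iff_det3_eq_zero _ hc h

namespace IsFrontal

variable {S : Set Plane} {f ν : Plane → Space} {q : Plane}

theorem contDiffAt (hf : IsFrontal S f ν) (hq : q ∈ S) : ContDiffAt ℝ ∞ f q :=
  hf.smooth.contDiffAt (hf.isOpen.mem_nhds hq)

theorem contDiffAt_normal (hf : IsFrontal S f ν) (hq : q ∈ S) : ContDiffAt ℝ ∞ ν q :=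
  hf.smooth_normal.contDiffAt (hf.isOpen.mem_nhds hq)

theorem differentiableAt (hf : IsFrontal S f ν) (hq : q ∈ S) : DifferentiableAt ℝ f q :=
  (hf.contDiffAt hq).differentiableAt (by simp)

theorem differentiableAt_normal (hf : IsFrontal S f ν) (hq : q ∈ S) : DifferentiableAt ℝ ν q :=
  (hf.contDiffAt_normal hq).differentiableAt (by simp)

theorem differentiableAt_fderiv (hf : IsFrontal S f ν) (hq : q ∈ S) (X : Plane) :
    DifferentiableAt ℝ (fun x => fderiv ℝ f x X) q :=
  (contDiffAt_fderiv_apply (hf.contDiffAt hq) X).differentiableAt (by simp)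

theorem differentiableAt_fderiv_normal (hf : IsFrontal S f ν) (hq : q ∈ S) (X : Plane) :
    DifferentiableAt ℝ (fun x => fderiv ℝ ν x X) q :=
  (contDiffAt_fderiv_apply (hf.contDiffAt_normal hq) X).differentiableAt (by simp)

theorem inner_normal_fderiv (hf : IsFrontal S f ν) (hq : q ∈ S) (X : Plane) :
    inner ℝ (fderiv ℝ ν q X) (ν q) = 0 := by
  have h1 : (fun x => inner ℝ (ν x) (ν x)) =ᶠ[𝓝 q] fun _ => (1 : ℝ) := by
    filter_upwards [hf.isOpen.mem_nhds hq] with x hx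
    exact inner_unit_self (hf.unit_normal x hx)
  have h2 := h1.fderiv_eq (𝕜 := ℝ)
  have hd := hf.differentiableAt_normal hq
  have h3 := fderiv_inner_apply ℝ hd hd X
  rw [h2, real_inner_comm] at h3
  simp at h3
  linarith

theorem inner_fderiv_fderiv_fderiv (hf : IsFrontal S f ν) (hq : q ∈ S) (X Y : Plane) :
    inner ℝ (fderiv ℝ (fun x => fderiv ℝ f x X) q Y) (ν q)
      = -inner ℝ (fderiv ℝ f q X) (fderiv ℝ ν q Y) := by
  have h1 : (fun x => inner ℝ (fderiv ℝ f x X) (ν x)) =ᶠ[𝓝 q] fun _ => (0 : ℝ) := by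
    filter_upwards [hf.isOpen.mem_nhds hq] with x hx
    exact hf.orthogonal x hx X
  have h2 := h1.fderiv_eq (𝕜 := ℝ)
  have h3 := fderiv_inner_apply ℝ (hf.differentiableAt_fderiv hq X)
    (hf.differentiableAt_normal hq) Y
  rw [h2] at h3
  simp at h3
  linarith

/-- The second fundamental form is symmetric. -/
theorem inner_fderiv_comm (hf : IsFrontal S f ν) (hq : q ∈ S) (X Y : Plane) :
    inner ℝ (fderiv ℝ f q X) (fderiv ℝ ν q Y) = inner ℝ (fderiv ℝ f q Y) (fderiv ℝ ν q X) := by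
  have h1 := hf.inner_fderiv_fderiv_fderiv hq X Y
  have h2 := hf.inner_fderiv_fderiv_fderiv hq Y X
  rw [fderiv_fderiv_comm (hf.contDiffAt hq)] at h1
  linarith

theorem isSingularPoint_iff (hf : IsFrontal S f ν) (hq : q ∈ S) :
    IsSingularPoint f q ↔ areaDensity f ν q = 0 :=
  isSingularPoint_iff_of_inner_eq_zero (hf.unit_normal q hq) (hf.orthogonal q hq)

theorem mem_regularSet_iff (hf : IsFrontal S f ν) (hq : q ∈ S) :
    q ∈ regularSet S f ↔ areaDensity f ν q ≠ 0 := by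
  simp [regularSet, hq, hf.isSingularPoint_iff hq]

theorem contDiffAt_areaDensity (hf : IsFrontal S f ν) (hq : q ∈ S) :
    ContDiffAt ℝ ∞ (areaDensity f ν) q :=
  contDiffAt_det3 (contDiffAt_fderiv_apply (hf.contDiffAt hq) _)
    (contDiffAt_fderiv_apply (hf.contDiffAt hq) _) (hf.contDiffAt_normal hq)

theorem contDiffAt_areaDensity_normal (hf : IsFrontal S f ν) (hq : q ∈ S) :
    ContDiffAt ℝ ∞ (areaDensity ν ν) q :=
  contDiffAt_det3 (contDiffAt_fderiv_apply (hf.contDiffAt_normal hq) _)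
    (contDiffAt_fderiv_apply (hf.contDiffAt_normal hq) _) (hf.contDiffAt_normal hq)

theorem contDiffAt_meanDensity (hf : IsFrontal S f ν) (hq : q ∈ S) :
    ContDiffAt ℝ ∞ (meanDensity f ν) q :=
  ((contDiffAt_det3 (contDiffAt_fderiv_apply (hf.contDiffAt hq) _)
    (contDiffAt_fderiv_apply (hf.contDiffAt_normal hq) _) (hf.contDiffAt_normal hq)).add
    (contDiffAt_det3 (contDiffAt_fderiv_apply (hf.contDiffAt_normal hq) _)
    (contDiffAt_fderiv_apply (hf.contDiffAt hq) _) (hf.contDiffAt_normal hq))).neg.div_const 2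

theorem det_firstForm (hf : IsFrontal S f ν) (hq : q ∈ S) :
    (firstForm f q).det = areaDensity f ν q ^ 2 := by
  have hg := det3_mul_det3 (partialU f q) (partialV f q) (ν q) (partialU f q) (partialV f q) (ν q)
  have hu := hf.orthogonal q hq (1, 0)
  have hv := hf.orthogonal q hq (0, 1)
  have hn := inner_unit_self (hf.unit_normal q hq)
  simp only [firstForm, Matrix.det_fin_two_of, areaDensity, partialU, partialV] at *
  rw [hu, hv, hn, real_inner_comm (fderiv ℝ f q (1, 0)) (fderiv ℝ f q (0, 1))] at hg
  linear_combination -hg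

theorem det_secondForm (hf : IsFrontal S f ν) (hq : q ∈ S) :
    (secondForm f ν q).det = areaDensity f ν q * areaDensity ν ν q := by
  have hg := det3_mul_det3 (partialU f q) (partialV f q) (ν q) (partialU ν q) (partialV ν q) (ν q)
  have hu := hf.orthogonal q hq (1, 0)
  have hv := hf.orthogonal q hq (0, 1)
  have hn := inner_unit_self (hf.unit_normal q hq)
  simp only [secondForm, Matrix.det_fin_two_of, areaDensity, partialU, partialV] at *
  rw [hu, hv, hn] at hg
  linear_combination -hg

/-- One factor of `det I = λ²` cancels against `det II = λμ`. At singular points both sides are `0`,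
the value of a division by zero. -/
theorem gaussianCurvature_eq (hf : IsFrontal S f ν) (hq : q ∈ S) :
    gaussianCurvature f ν q = areaDensity ν ν q / areaDensity f ν q := by
  rw [gaussianCurvature, hf.det_firstForm hq, hf.det_secondForm hq]
  by_cases h : areaDensity f ν q = 0
  · simp [h]
  · field_simp

theorem meanCurvature_eq (hf : IsFrontal S f ν) (hq : q ∈ S) :
    meanCurvature f ν q = meanDensity f ν q / areaDensity f ν q := by
  have h1 := det3_mul_det3 (partialU f q) (partialV ν q) (ν q) (partialU f q) (partialV f q) (ν q)
  have h2 := det3_mul_det3 (partialU ν q) (partialV f q) (ν q) (partialU f q) (partialV f q) (ν q)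
  have hu := hf.orthogonal q hq (1, 0)
  have hv := hf.orthogonal q hq (0, 1)
  have hu' := hf.inner_normal_fderiv hq (1, 0)
  have hv' := hf.inner_normal_fderiv hq (0, 1)
  have hs := hf.inner_fderiv_comm hq (1, 0) (0, 1)
  have hn := inner_unit_self (hf.unit_normal q hq)
  rw [meanCurvature, hf.det_firstForm hq]
  -- Multiplying each mixed determinant by `λ` turns it into inner products; the symmetry of the
  -- second form then merges the two middle terms.
  have key : firstForm f q 1 1 * secondForm f ν q 0 0
      - 2 * firstForm f q 0 1 * secondForm f ν q 0 1
      + firstForm f q 0 0 * secondForm f ν q 1 1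
      = 2 * (meanDensity f ν q * areaDensity f ν q) := by
    simp only [firstForm, secondForm, areaDensity, meanDensity, partialU, partialV,
      Matrix.of_apply, Matrix.cons_val', Matrix.cons_val_zero, Matrix.cons_val_one,
      Matrix.cons_val_fin_one] at *
    rw [hv', hu, hn, real_inner_comm (fderiv ℝ f q _) (fderiv ℝ ν q _),
      real_inner_comm (fderiv ℝ f q _) (fderiv ℝ ν q _)] at h1
    rw [hu', hv, hn, real_inner_comm (fderiv ℝ f q _) (fderiv ℝ ν q _),
      real_inner_comm (fderiv ℝ f q _) (fderiv ℝ ν q _),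
      real_inner_comm (fderiv ℝ f q (1, 0)) (fderiv ℝ f q (0, 1))] at h2
    rw [hs] at h1 ⊢
    linear_combination h1 + h2
  rw [key]
  by_cases h : areaDensity f ν q = 0
  · simp [h]
  · field_simp

end IsFrontal

/-! ### The smooth curvature radius and the normal of the focal surface. -/

/-- The discriminant `h² - λ μ` of the quadratic equation for the curvature radii. -/
noncomputable def discriminantDensity (f ν : Plane → Space) (q : Plane) : ℝ :=
  meanDensity f ν q ^ 2 - areaDensity f ν q * areaDensity ν ν q

/-- The root `λ / (h + s √(h² - λ μ))` of the quadratic equation `μ ρ² - 2 h ρ + λ = 0` for the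
curvature radii; for `s = sign h` it is the small one. -/
noncomputable def smallRadius (f ν : Plane → Space) (s : ℝ) (q : Plane) : ℝ :=
  areaDensity f ν q / (meanDensity f ν q + s * √(discriminantDensity f ν q))

/-- The part of `S` on which `smallRadius f ν s` is smooth. -/
def radiusDomain (S : Set Plane) (f ν : Plane → Space) (s : ℝ) : Set Plane :=
  {q | q ∈ S ∧ 0 < s * meanDensity f ν q ∧ 0 < discriminantDensity f ν q}

/-- The component of the derivative of the focal surface tangent to the original surface. -/
noncomputable def focalTangent (f ν : Plane → Space) (s : ℝ) (X q : Plane) : Space :=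
  fderiv ℝ f q X + smallRadius f ν s q • fderiv ℝ ν q X

namespace IsFrontal

variable {S : Set Plane} {f ν : Plane → Space} {q : Plane} {s : ℝ}

theorem contDiffAt_discriminantDensity (hf : IsFrontal S f ν) (hq : q ∈ S) :
    ContDiffAt ℝ ∞ (discriminantDensity f ν) q :=
  ((hf.contDiffAt_meanDensity hq).pow 2).sub
    ((hf.contDiffAt_areaDensity hq).mul (hf.contDiffAt_areaDensity_normal hq))

theorem radiusDomain_mem_nhds (hf : IsFrontal S f ν) (hq : q ∈ radiusDomain S f ν s) :
    radiusDomain S f ν s ∈ 𝓝 q := by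
  obtain ⟨h1, h2, h3⟩ := hq
  have hh : ContinuousAt (fun x => s * meanDensity f ν x) q :=
    (hf.contDiffAt_meanDensity h1).continuousAt.const_mul s
  have hd := (hf.contDiffAt_discriminantDensity h1).continuousAt
  filter_upwards [hf.isOpen.mem_nhds h1, hh.eventually (lt_mem_nhds h2),
    hd.eventually (lt_mem_nhds h3)] with x a b c
  exact ⟨a, b, c⟩

/-- Multiplied by `s`, the denominator is a positive term plus a square root. -/
theorem denominator_ne_zero (hs : s * s = 1) (hq : q ∈ radiusDomain S f ν s) :
    meanDensity f ν q + s * √(discriminantDensity f ν q) ≠ 0 := by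
  intro h
  have h1 := hq.2.1
  have h2 := Real.sqrt_nonneg (discriminantDensity f ν q)
  have h3 : s * meanDensity f ν q + s * s * √(discriminantDensity f ν q) = 0 := by
    linear_combination s * h
  rw [hs] at h3
  linarith

theorem contDiffAt_smallRadius (hf : IsFrontal S f ν) (hs : s * s = 1)
    (hq : q ∈ radiusDomain S f ν s) : ContDiffAt ℝ ∞ (smallRadius f ν s) q :=
  (hf.contDiffAt_areaDensity hq.1).div ((hf.contDiffAt_meanDensity hq.1).add
    (contDiffAt_const.mul ((hf.contDiffAt_discriminantDensity hq.1).sqrt hq.2.2.ne')))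
    (denominator_ne_zero hs hq)

theorem smallRadius_quadratic (hs : s * s = 1) (hq : q ∈ radiusDomain S f ν s) :
    areaDensity ν ν q * smallRadius f ν s q ^ 2 - 2 * meanDensity f ν q * smallRadius f ν s q
      + areaDensity f ν q = 0 := by
  have h0 := denominator_ne_zero hs hq
  have h1 := Real.sq_sqrt hq.2.2.le
  rw [smallRadius]
  set w := √(discriminantDensity f ν q)
  rw [discriminantDensity] at h1
  field_simp
  linear_combination areaDensity f ν q * h1 + areaDensity f ν q * w ^ 2 * hs

/-- The sign of `H` is `s` times the sign of `λ`, and `√(λ²) = |λ|` contributes the sign of `λ` once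
more. The two cancel and leave `(h + s√(h² - λμ))/λ`, with no jump across the singular curve. -/
theorem unboundedCurvatureRadius_eq (hf : IsFrontal S f ν) (hs : s * s = 1)
    (hq : q ∈ radiusDomain S f ν s) :
    unboundedCurvatureRadius f ν q = smallRadius f ν s q := by
  rw [unboundedCurvatureRadius, hf.isSingularPoint_iff hq.1]
  by_cases hl : areaDensity f ν q = 0
  · simp [hl, smallRadius]
  rw [if_neg hl, unboundedPrincipalCurvature, hf.meanCurvature_eq hq.1,
    hf.gaussianCurvature_eq hq.1]
  have hsq : (meanDensity f ν q / areaDensity f ν q) ^ 2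
      - areaDensity ν ν q / areaDensity f ν q
      = discriminantDensity f ν q / areaDensity f ν q ^ 2 := by
    rw [discriminantDensity]
    field_simp
  rw [hsq, Real.sqrt_div' _ (sq_nonneg _), Real.sqrt_sq_eq_abs, smallRadius]
  have h2 := hq.2.1
  set l := areaDensity f ν q
  set h := meanDensity f ν q
  set w := √(discriminantDensity f ν q)
  have key : (if 0 ≤ h / l then h / l + w / |l| else h / l - w / |l|) = (h + s * w) / l := by
    have hs' : s = 1 ∨ s = -1 := mul_self_eq_one_iff.1 hs
    rcases lt_or_gt_of_ne hl with hneg | hpos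
    · rw [abs_of_neg hneg]
      rcases hs' with rfl | rfl
      · rw [if_neg (not_le.2 (div_neg_of_pos_of_neg (by linarith) hneg))]
        field_simp
        ring
      · rw [if_pos (div_nonneg_of_nonpos (by linarith) hneg.le)]
        field_simp
    · rw [abs_of_pos hpos]
      rcases hs' with rfl | rfl
      · rw [if_pos (div_nonneg (by linarith) hpos.le)]
        field_simp
      · rw [if_neg (not_le.2 (div_neg_of_neg_of_pos (by linarith) hpos))]
        field_simp
        ring
  rw [key, one_div_div]

theorem focalSurface_eventuallyEq (hf : IsFrontal S f ν) (hs : s * s = 1)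
    (hq : q ∈ radiusDomain S f ν s) :
    focalSurface f ν =ᶠ[𝓝 q] fun x => f x + smallRadius f ν s x • ν x := by
  filter_upwards [hf.radiusDomain_mem_nhds hq] with x hx
  rw [focalSurface, hf.unboundedCurvatureRadius_eq hs hx]

theorem contDiffAt_focalSurface (hf : IsFrontal S f ν) (hs : s * s = 1)
    (hq : q ∈ radiusDomain S f ν s) : ContDiffAt ℝ ∞ (focalSurface f ν) q :=
  ((hf.contDiffAt hq.1).add ((hf.contDiffAt_smallRadius hs hq).smul
    (hf.contDiffAt_normal hq.1))).congr_of_eventuallyEq (hf.focalSurface_eventuallyEq hs hq)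

theorem fderiv_focalSurface (hf : IsFrontal S f ν) (hs : s * s = 1)
    (hq : q ∈ radiusDomain S f ν s) (X : Plane) :
    fderiv ℝ (focalSurface f ν) q X
      = focalTangent f ν s X q + fderiv ℝ (smallRadius f ν s) q X • ν q := by
  rw [(hf.focalSurface_eventuallyEq hs hq).fderiv_eq]
  have h1 := (hf.differentiableAt hq.1).hasFDerivAt
  have h2 := (hf.differentiableAt_normal hq.1).hasFDerivAt
  have h3 := ((hf.contDiffAt_smallRadius hs hq).differentiableAt (by simp)).hasFDerivAt
  have h4 := (h1.add (h3.smul h2)).fderiv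
  simp only [Pi.add_def, Pi.smul_def'] at h4
  rw [h4]
  simp [focalTangent, add_assoc]

theorem contDiffAt_focalTangent (hf : IsFrontal S f ν) (hs : s * s = 1)
    (hq : q ∈ radiusDomain S f ν s) (X : Plane) :
    ContDiffAt ℝ ∞ (focalTangent f ν s X) q :=
  (contDiffAt_fderiv_apply (hf.contDiffAt hq.1) X).add ((hf.contDiffAt_smallRadius hs hq).smul
    (contDiffAt_fderiv_apply (hf.contDiffAt_normal hq.1) X))

theorem inner_focalTangent_normal (hf : IsFrontal S f ν) (hq : q ∈ S) (X : Plane) :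
    inner ℝ (focalTangent f ν s X q) (ν q) = 0 := by
  rw [focalTangent, inner_add_left, real_inner_smul_left, hf.orthogonal q hq,
    hf.inner_normal_fderiv hq]
  simp

/-- The vectors `focalTangent f ν s X q` are all parallel. -/
theorem det3_focalTangent (hs : s * s = 1) (hq : q ∈ radiusDomain S f ν s) (X Y : Plane) :
    det3 (focalTangent f ν s X q) (focalTangent f ν s Y q) (ν q) = 0 := by
  have h := smallRadius_quadratic hs hq
  have h2 := det3_apply_apply (fderiv ℝ f q + smallRadius f ν s q • fderiv ℝ ν q) (ν q) X Y
  simp only [add_apply, smul_apply] at h2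
  rw [focalTangent, focalTangent, h2]
  -- Expanded in `ρ`, the remaining determinant is the left side of the quadratic equation for the
  -- curvature radii.
  apply mul_eq_zero_of_right
  refine Eq.trans ?_ h
  simp only [areaDensity, meanDensity, partialU, partialV, det3_eq, PiLp.add_apply,
    PiLp.smul_apply, smul_eq_mul]
  ring

theorem inner_fderiv_focalSurface_cross3 (hf : IsFrontal S f ν) (hs : s * s = 1)
    (hq : q ∈ radiusDomain S f ν s) (X Y : Plane) :
    inner ℝ (fderiv ℝ (focalSurface f ν) q X) (cross3 (focalTangent f ν s Y q) (ν q)) = 0 := by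
  rw [inner_cross3, hf.fderiv_focalSurface hs hq]
  have h := det3_focalTangent hs hq X Y
  rw [det3_eq] at h ⊢
  simp only [PiLp.add_apply, PiLp.smul_apply, smul_eq_mul]
  linear_combination h

theorem inner_cross3_focalTangent (hf : IsFrontal S f ν) (hq : q ∈ S) (X : Plane) :
    inner ℝ (cross3 (focalTangent f ν s X q) (ν q)) (cross3 (focalTangent f ν s X q) (ν q))
      = ‖focalTangent f ν s X q‖ ^ 2 := by
  rw [inner_cross3_self, hf.inner_focalTangent_normal hq, inner_unit_self (hf.unit_normal q hq),
    real_inner_self_eq_norm_sq]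
  ring

/-- Away from the zeros of `focalTangent f ν s X`, the focal surface is a frontal. -/
theorem isFrontal_focalSurface (hf : IsFrontal S f ν) (hs : s * s = 1) (X : Plane) :
    IsFrontal {q | q ∈ radiusDomain S f ν s ∧ focalTangent f ν s X q ≠ 0} (focalSurface f ν)
      (fun q => ‖focalTangent f ν s X q‖⁻¹ • cross3 (focalTangent f ν s X q) (ν q)) where
  isOpen := by
    rw [isOpen_iff_mem_nhds]
    rintro q ⟨h1, h2⟩
    filter_upwards [hf.radiusDomain_mem_nhds h1,
      (hf.contDiffAt_focalTangent hs h1 X).continuousAt.eventually_ne h2] with x a b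
    exact ⟨a, b⟩
  smooth := fun q hq => (hf.contDiffAt_focalSurface hs hq.1).contDiffWithinAt
  smooth_normal := fun q hq => by
    have h := hf.contDiffAt_focalTangent hs hq.1 X
    exact (((h.norm ℝ hq.2).inv (norm_ne_zero_iff.2 hq.2)).smul
      (contDiffAt_cross3 h (hf.contDiffAt_normal hq.1.1))).contDiffWithinAt
  unit_normal := fun q hq => by
    have h := hf.inner_cross3_focalTangent (s := s) hq.1.1 X
    rw [real_inner_self_eq_norm_sq] at h
    have h2 := (pow_left_inj₀ (norm_nonneg _) (norm_nonneg _) two_ne_zero).1 h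
    rw [norm_smul, h2, norm_inv, norm_norm, inv_mul_cancel₀ (norm_ne_zero_iff.2 hq.2)]
  orthogonal := fun q hq Y => by
    rw [real_inner_smul_right, hf.inner_fderiv_focalSurface_cross3 hs hq.1, mul_zero]

/-- At a regular point of the focal surface, every unit normal of it is orthogonal to `ν` and to
the vectors `focalTangent f ν s X q`. -/
theorem orthogonal_of_regular (hf : IsFrontal S f ν) (hs : s * s = 1)
    (hq : q ∈ radiusDomain S f ν s) {U : Set Plane} {n : Plane → Space}
    (hn : IsFrontal U (focalSurface f ν) n) (hqU : q ∈ U) {X : Plane}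
    (hX : focalTangent f ν s X q ≠ 0) (hr : areaDensity (focalSurface f ν) n q ≠ 0) :
    inner ℝ (n q) (ν q) = 0 ∧ inner ℝ (n q) (focalTangent f ν s X q) = 0 := by
  set w := cross3 (focalTangent f ν s X q) (ν q)
  have hw : w ≠ 0 := by
    intro h0
    have h := hf.inner_cross3_focalTangent (s := s) hq.1 X
    change inner ℝ w w = _ at h
    rw [h0, inner_zero_left] at h
    exact hX (norm_eq_zero.1 (pow_eq_zero_iff two_ne_zero |>.1 h.symm))
  -- The part of `w` orthogonal to `n` is also orthogonal to the image of `dĈ`, so it vanishes at a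
  -- regular point: `w` is a multiple of `n`.
  have h1 : ∀ Y, inner ℝ (w - inner ℝ w (n q) • n q) (fderiv ℝ (focalSurface f ν) q Y) = 0 := by
    intro Y
    rw [real_inner_comm, inner_sub_right, real_inner_smul_right,
      hf.inner_fderiv_focalSurface_cross3 hs hq, hn.orthogonal q hqU]
    simp
  have h2 : inner ℝ (w - inner ℝ w (n q) • n q) (n q) = 0 := by
    rw [inner_sub_left, real_inner_smul_left, inner_unit_self (hn.unit_normal q hqU)]
    ring
  have h3 := sub_eq_zero.1 (eq_zero_of_inner_eq_zero hr (h1 _) (h1 _) h2)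
  have h4 : inner ℝ w (n q) ≠ 0 := by
    intro h
    rw [h, zero_smul] at h3
    exact hw h3
  have h5 : ∀ v, inner ℝ v w = 0 → inner ℝ (n q) v = 0 := by
    intro v hv
    rw [h3, real_inner_smul_right] at hv
    rw [real_inner_comm]
    exact (mul_eq_zero.1 hv).resolve_left h4
  refine ⟨h5 _ ?_, h5 _ ?_⟩
  · rw [inner_cross3, det3_eq]; ring
  · rw [inner_cross3, det3_eq]; ring

/-- If the differential of the signed area density does not vanish at `p`, then the zero set of the
signed area density has no interior near `p`: continuous equations extend from its complement. -/
theorem eventually_eq_zero_of_nondegenerate {p : Plane} (hf : IsFrontal S f ν) (hp : p ∈ S)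
    (hd : fderiv ℝ (areaDensity f ν) p ≠ 0) {g : Plane → ℝ}
    (hg : ∀ᶠ q in 𝓝 p, ContinuousAt g q)
    (h : ∀ᶠ q in 𝓝 p, areaDensity f ν q ≠ 0 → g q = 0) : ∀ᶠ q in 𝓝 p, g q = 0 := by
  have hc : ContinuousAt (fderiv ℝ (areaDensity f ν)) p :=
    ((hf.contDiffAt_areaDensity hp).fderiv_right (m := ∞) (by simp)).continuousAt
  filter_upwards [hg, h.eventually_nhds, hc.eventually_ne hd] with q h1 h2 h3
  by_contra h0
  refine h3 ?_
  -- Where `g` is nonzero it stays nonzero nearby, which forces the density to vanish on a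
  -- neighborhood, against its nonzero differential.
  have : areaDensity f ν =ᶠ[𝓝 q] fun _ => (0 : ℝ) := by
    filter_upwards [h2, h1.eventually_ne h0] with x hx hx'
    by_contra hne
    exact hx' (hx hne)
  rw [this.fderiv_eq]
  simp

end IsFrontal

/-! ### Limits along rays and linear forms on directions. -/

theorem tendsto_polarPoint (p : Plane) (θ : ℝ) :
    Tendsto (fun r => polarPoint p r θ) (𝓝[>] 0) (𝓝 p) := by
  have h : Continuous (fun r : ℝ => polarPoint p r θ) := by
    unfold polarPoint
    fun_prop
  have h2 := h.tendsto 0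
  simp only [polarPoint, zero_smul, add_zero] at h2
  exact h2.mono_left nhdsWithin_le_nhds

theorem tendsto_div_polarPoint {g : Plane → ℝ} {p : Plane} (hg : DifferentiableAt ℝ g p)
    (h0 : g p = 0) (θ : ℝ) : Tendsto (fun r => g (polarPoint p r θ) / r) (𝓝[>] 0)
      (𝓝 (fderiv ℝ g p (Real.cos θ, Real.sin θ))) := by
  have h1 : HasDerivAt (fun r : ℝ => polarPoint p r θ) (Real.cos θ, Real.sin θ) 0 := by
    simpa [polarPoint] using
      ((hasDerivAt_id (0 : ℝ)).smul_const (Real.cos θ, Real.sin θ)).const_add p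
  have hp : polarPoint p 0 θ = p := by simp [polarPoint]
  have h2 : HasFDerivAt g (fderiv ℝ g p) (polarPoint p 0 θ) := by
    rw [hp]; exact hg.hasFDerivAt
  have h3 := (h2.comp_hasDerivAt (0 : ℝ) h1).tendsto_slope_zero_right
  refine h3.congr fun r => ?_
  simp [hp, h0, div_eq_inv_mul]

theorem eventually_ne_polarPoint {g : Plane → ℝ} {p : Plane} (hg : DifferentiableAt ℝ g p)
    (h0 : g p = 0) {θ : ℝ} (h : fderiv ℝ g p (Real.cos θ, Real.sin θ) ≠ 0) :
    ∀ᶠ r in 𝓝[>] (0 : ℝ), g (polarPoint p r θ) ≠ 0 := by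
  filter_upwards [(tendsto_div_polarPoint hg h0 θ).eventually_ne h] with r hr h1
  exact hr (by rw [h1, zero_div])

/-- A nonzero linear form on the plane vanishes in finitely many directions only. -/
theorem finite_setOf_apply_direction_eq_zero {L : Plane →L[ℝ] ℝ} (hL : L ≠ 0) :
    {θ | θ ∈ Set.Ico 0 (2 * Real.pi) ∧ L (Real.cos θ, Real.sin θ) = 0}.Finite := by
  rcases Set.eq_empty_or_nonempty
    {θ | θ ∈ Set.Ico 0 (2 * Real.pi) ∧ L (Real.cos θ, Real.sin θ) = 0} with h | ⟨φ, hφ, hφ0⟩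
  · rw [h]; exact Set.finite_empty
  -- Two zeros in `[0, 2π)` differ by `kπ` with `|k| < 2`, since otherwise their directions span the
  -- plane.
  refine ((Set.finite_Icc (-2 : ℤ) 2).image fun k : ℤ => φ + k * Real.pi).subset ?_
  rintro θ ⟨hθ, hθ0⟩
  have hsin : Real.sin (θ - φ) = 0 := by
    by_contra hne
    rw [Real.sin_sub] at hne
    rw [apply_plane] at hθ0 hφ0
    simp only [smul_eq_mul] at hθ0 hφ0
    have h1 : L (1, 0) = 0 := by
      apply (mul_eq_zero_iff_left hne).1
      linear_combination Real.sin θ * hφ0 - Real.sin φ * hθ0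
    have h2 : L (0, 1) = 0 := by
      apply (mul_eq_zero_iff_left hne).1
      linear_combination Real.cos φ * hθ0 - Real.cos θ * hφ0
    apply hL
    ext <;> simp [h1, h2]
  obtain ⟨k, hk⟩ := Real.sin_eq_zero_iff.1 hsin
  have hpi := Real.pi_pos
  refine ⟨k, ⟨?_, ?_⟩, by simp only; linarith⟩
  · have : (-2 : ℝ) < k := by nlinarith [hθ.1, hφ.2]
    exact_mod_cast this.le
  · have : (k : ℝ) < 2 := by nlinarith [hθ.2, hφ.1]
    exact_mod_cast this.le

theorem exists_direction (X : Plane) :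
    ∃ θ ∈ Set.Ico 0 (2 * Real.pi), ∃ R : ℝ, X = R • (Real.cos θ, Real.sin θ) := by
  set z : ℂ := ⟨X.1, X.2⟩
  refine ⟨toIcoMod Real.two_pi_pos 0 z.arg, ?_, ‖z‖, ?_⟩
  · simpa using toIcoMod_mem_Ico Real.two_pi_pos 0 z.arg
  · rw [toIcoMod, zsmul_eq_mul, Real.cos_sub_int_mul_two_pi, Real.sin_sub_int_mul_two_pi]
    ext
    · simp [Complex.norm_mul_cos_arg, z]
    · simp [Complex.norm_mul_sin_arg, z]

/-- An inequality `|M| ≤ B |L|` between linear forms that holds in all but finitely many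
directions holds everywhere on the kernel of `L`. -/
theorem apply_eq_zero_of_direction_le {L M : Plane →L[ℝ] ℝ} {B : ℝ} {T : Set ℝ} (hT : T.Finite)
    (h : ∀ θ ∈ Set.Ico 0 (2 * Real.pi) \ T,
      |M (Real.cos θ, Real.sin θ)| ≤ B * |L (Real.cos θ, Real.sin θ)|)
    {X : Plane} (hX : L X = 0) : M X = 0 := by
  obtain ⟨φ, hφ, R, rfl⟩ := exists_direction X
  rw [map_smul, smul_eq_mul] at hX ⊢
  rcases mul_eq_zero.1 hX with hR | hL
  · simp [hR]
  apply mul_eq_zero_of_right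
  have hcont : ∀ N : Plane →L[ℝ] ℝ, Tendsto (fun θ => |N (Real.cos θ, Real.sin θ)|) (𝓝[>] φ)
      (𝓝 |N (Real.cos φ, Real.sin φ)|) := by
    intro N
    have : Continuous (fun θ => |N (Real.cos θ, Real.sin θ)|) := by fun_prop
    exact (this.tendsto φ).mono_left nhdsWithin_le_nhds
  -- `φ` itself may be an excluded direction, so it is approached through admissible ones, from the
  -- right because `φ` may be `0`.
  have hle := le_of_tendsto_of_tendsto (hcont M) ((hcont L).const_mul B) (by
    have h1 : ∀ᶠ θ in 𝓝[>] φ, θ ∈ Set.Ioo φ (2 * Real.pi) := Ioo_mem_nhdsGT hφ.2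
    have h2 : ∀ᶠ θ in 𝓝[>] φ, θ ∉ T \ {φ} :=
      nhdsWithin_le_nhds ((hT.subset Set.sdiff_subset).isClosed.isOpen_compl.mem_nhds (by simp))
    filter_upwards [h1, h2] with θ ha hb
    exact h θ ⟨⟨hφ.1.trans ha.1.le, ha.2⟩, fun hc => hb ⟨hc, ha.1.ne'⟩⟩)
  rw [hL, abs_zero, mul_zero] at hle
  exact abs_eq_zero.1 (le_antisymm hle (abs_nonneg _))

theorem exists_mem_Ico_notMem {T : Set ℝ} (hT : T.Finite) :
    ∃ θ, θ ∈ Set.Ico 0 (2 * Real.pi) \ T :=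
  ((Set.Ico_infinite Real.two_pi_pos).sdiff hT).nonempty

/-! ### Analysis at the singular point of the second kind. -/

section

variable {S : Set Plane} {f ν : Plane → Space} {p : Plane}

/-- At a singular point of the second kind there is a null vector tangent to the singular curve. -/
theorem IsSecondKind.exists_null (h : IsSecondKind S f ν p) (hf : IsFrontal S f ν) (hp : p ∈ S) :
    ∃ η : Plane, η ≠ 0 ∧ fderiv ℝ f p η = 0 ∧ fderiv ℝ (areaDensity f ν) p η = 0 := by
  obtain ⟨⟨hs, -⟩, U, -, hpU, -, ε, γ, η, hγ, hη, hli⟩ := h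
  have h0 : (0 : ℝ) ∈ Set.Ioo (-ε) ε := ⟨by linarith [hγ.pos], hγ.pos⟩
  have hnhds := isOpen_Ioo.mem_nhds h0
  have hγd : HasDerivAt γ (deriv γ 0) 0 :=
    ((hγ.smooth.contDiffAt hnhds).differentiableAt (by simp)).hasDerivAt
  have hl : HasFDerivAt (areaDensity f ν) (fderiv ℝ (areaDensity f ν) p) (γ 0) := by
    rw [hγ.base]
    exact ((hf.contDiffAt_areaDensity hp).differentiableAt (by simp)).hasFDerivAt
  have h1 := hl.comp_hasDerivAt (0 : ℝ) hγd
  have h2 : areaDensity f ν ∘ γ =ᶠ[𝓝 0] fun _ => (0 : ℝ) := by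
    filter_upwards [hnhds] with t ht
    exact hγ.singular t ht
  have h3 : fderiv ℝ (areaDensity f ν) p (deriv γ 0) = 0 := by
    rw [← h1.deriv, h2.deriv_eq, deriv_const]
  rw [LinearIndependent.pair_iff' (hγ.regular 0 h0)] at hli
  push Not at hli
  obtain ⟨a, ha⟩ := hli
  exact ⟨η p, hη.ne_zero p hpU, hη.null p hpU hs, by rw [← ha, map_smul, h3, smul_zero]⟩

/-- Every term of the derivative of `det(f_u, f_v, ν)` keeps a factor `f_u` or `f_v`. -/
theorem IsFrontal.exists_fderiv_ne_zero (hf : IsFrontal S f ν) (hp : p ∈ S)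
    (h : fderiv ℝ (areaDensity f ν) p ≠ 0) : ∃ X, fderiv ℝ f p X ≠ 0 := by
  by_contra! h0
  apply h
  refine ContinuousLinearMap.ext fun X => ?_
  unfold areaDensity partialU partialV
  rw [fderiv_det3 (hf.differentiableAt_fderiv hp _) (hf.differentiableAt_fderiv hp _)
    (hf.differentiableAt_normal hp), h0, h0]
  simp [det3_eq]

theorem IsFront.fderiv_normal_ne_zero (hf : IsFront S f ν) (hp : p ∈ S) {X : Plane} (hX : X ≠ 0)
    (h : fderiv ℝ f p X = 0) : fderiv ℝ ν p X ≠ 0 := fun h' =>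
  hX (hf.immersion p hp (by simp [h, h']))

/-- On `X`, `Y` the mixed determinant reduces to `det(df X, dν Y, ν)`. Its entries are mutually
orthogonal, by symmetry of the second form, and nonzero, by the front condition. -/
theorem IsFront.meanDensity_ne_zero (hf : IsFront S f ν) (hp : p ∈ S) {X Y : Plane}
    (hX : fderiv ℝ f p X ≠ 0) (hY : Y ≠ 0) (hY0 : fderiv ℝ f p Y = 0) :
    meanDensity f ν p ≠ 0 := by
  have hν := hf.fderiv_normal_ne_zero hp hY hY0
  have h1 := det3_mul_det3 (fderiv ℝ f p X) (fderiv ℝ ν p Y) (ν p)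
    (fderiv ℝ f p X) (fderiv ℝ ν p Y) (ν p)
  rw [hf.inner_fderiv_comm hp X Y, hf.orthogonal p hp X, hf.inner_normal_fderiv hp Y, hY0,
    inner_unit_self (hf.unit_normal p hp), inner_zero_left] at h1
  have h2 := det3_apply_apply_add (fderiv ℝ f p) (fderiv ℝ ν p) (ν p) X Y
  have h3 : det3 (fderiv ℝ ν p X) (fderiv ℝ f p Y) (ν p) = 0 := by
    rw [hY0, det3_eq]; simp
  intro h
  have h4 : det3 (fderiv ℝ f p (1, 0)) (fderiv ℝ ν p (0, 1)) (ν p)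
      + det3 (fderiv ℝ ν p (1, 0)) (fderiv ℝ f p (0, 1)) (ν p) = 0 := by
    unfold meanDensity partialU partialV at h
    linarith
  rw [h3, h4, mul_zero, add_zero] at h2
  rw [h2] at h1
  have h5 : inner ℝ (fderiv ℝ f p X) (fderiv ℝ f p X)
      * inner ℝ (fderiv ℝ ν p Y) (fderiv ℝ ν p Y) = 0 := by linarith
  rcases mul_eq_zero.1 h5 with h6 | h6
  · exact hX (inner_self_eq_zero.1 h6)
  · exact hν (inner_self_eq_zero.1 h6)

/-- Under either hypothesis on the Gaussian curvature, the area density of the Gauss map is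
dominated by that of the frontal along almost all rays. -/
theorem IsFrontal.exists_abs_le_of_gaussianCurvature (hf : IsFrontal S f ν) (hp : p ∈ S)
    (h0 : areaDensity f ν p = 0) (hd : fderiv ℝ (areaDensity f ν) p ≠ 0)
    (hK : IsBoundedNear (regularSet S f) (gaussianCurvature f ν) p ∨
      IsRationallyContinuous (regularSet S f) (gaussianCurvature f ν) p) :
    ∃ (B : ℝ) (T : Set ℝ), T.Finite ∧ ∀ θ ∈ Set.Ico 0 (2 * Real.pi) \ T,
      ∀ᶠ r in 𝓝[>] (0 : ℝ), |areaDensity ν ν (polarPoint p r θ)|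
        ≤ B * |areaDensity f ν (polarPoint p r θ)| := by
  have key : ∀ {q : Plane} {B : ℝ}, q ∈ regularSet S f → |gaussianCurvature f ν q| ≤ B →
      |areaDensity ν ν q| ≤ B * |areaDensity f ν q| := by
    intro q B hq hB
    have hne := (hf.mem_regularSet_iff hq.1).1 hq
    rwa [hf.gaussianCurvature_eq hq.1, abs_div, div_le_iff₀ (abs_pos.2 hne)] at hB
  rcases hK with ⟨W, hW, B, hB⟩ | ⟨c, T, hT, h⟩
  · refine ⟨B, _, finite_setOf_apply_direction_eq_zero hd, fun θ hθ => ?_⟩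
    have hne : fderiv ℝ (areaDensity f ν) p (Real.cos θ, Real.sin θ) ≠ 0 :=
      fun h => hθ.2 ⟨hθ.1, h⟩
    filter_upwards [tendsto_polarPoint p θ hW, tendsto_polarPoint p θ (hf.isOpen.mem_nhds hp),
      eventually_ne_polarPoint ((hf.contDiffAt_areaDensity hp).differentiableAt (by simp))
        h0 hne] with r h1 h2 h3
    have hr := (hf.mem_regularSet_iff h2).2 h3
    exact key hr (hB _ ⟨h1, hr⟩)
  · refine ⟨|c| + 1, T, hT, fun θ hθ => ?_⟩
    obtain ⟨h1, h2⟩ := h θ hθ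
    filter_upwards [h1, h2.abs.eventually (gt_mem_nhds (lt_add_one |c|))] with r h3 h4
    exact key h3 h4.le

/-- If the area density of the Gauss map is dominated by that of the frontal along almost all
rays, then it vanishes at the singular point and its derivative vanishes in the direction of the
singular curve. -/
theorem IsFrontal.areaDensity_normal_eq_zero (hf : IsFrontal S f ν) (hp : p ∈ S)
    (h0 : areaDensity f ν p = 0) {B : ℝ} {T : Set ℝ} (hT : T.Finite)
    (h : ∀ θ ∈ Set.Ico 0 (2 * Real.pi) \ T,
      ∀ᶠ r in 𝓝[>] (0 : ℝ), |areaDensity ν ν (polarPoint p r θ)|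
        ≤ B * |areaDensity f ν (polarPoint p r θ)|) :
    areaDensity ν ν p = 0 ∧ ∀ X, fderiv ℝ (areaDensity f ν) p X = 0 →
      fderiv ℝ (areaDensity ν ν) p X = 0 := by
  have hl := hf.contDiffAt_areaDensity hp
  have hm := hf.contDiffAt_areaDensity_normal hp
  have hm0 : areaDensity ν ν p = 0 := by
    obtain ⟨θ, hθ⟩ := exists_mem_Ico_notMem hT
    have h1 := le_of_tendsto_of_tendsto
      (hm.continuousAt.tendsto.comp (tendsto_polarPoint p θ)).abs
      ((hl.continuousAt.tendsto.comp (tendsto_polarPoint p θ)).abs.const_mul B) (h θ hθ)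
    rw [h0, abs_zero, mul_zero] at h1
    exact abs_eq_zero.1 (le_antisymm h1 (abs_nonneg _))
  -- Both densities vanish at `p`, so dividing the bound by `r` and letting `r → 0` compares their
  -- differentials.
  refine ⟨hm0, fun X hX => apply_eq_zero_of_direction_le (B := B) hT (fun θ hθ => ?_) hX⟩
  refine le_of_tendsto_of_tendsto
    (tendsto_div_polarPoint (hm.differentiableAt (by simp)) hm0 θ).abs
    ((tendsto_div_polarPoint (hl.differentiableAt (by simp)) h0 θ).abs.const_mul B) ?_
  filter_upwards [h θ hθ, self_mem_nhdsWithin] with r hr hr0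
  have hr0' : 0 < |r| := abs_pos.2 (ne_of_gt hr0)
  rw [abs_div, abs_div, ← mul_div_assoc]
  exact div_le_div_of_nonneg_right hr hr0'.le

/-- The Gaussian curvature of a frontal is rationally bounded at a non-degenerate singular point at
which the Gauss map is singular. -/
theorem IsFrontal.isRationallyBounded_gaussianCurvature (hf : IsFrontal S f ν) (hp : p ∈ S)
    (h : IsNondegenerateSingularPoint f ν p) (hm0 : areaDensity ν ν p = 0) :
    IsRationallyBounded (regularSet S f) (gaussianCurvature f ν) p := by
  have hl := (hf.contDiffAt_areaDensity hp).differentiableAt (by simp)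
  have hm := (hf.contDiffAt_areaDensity_normal hp).differentiableAt (by simp)
  have h0 := (hf.isSingularPoint_iff hp).1 h.1
  refine ⟨_, finite_setOf_apply_direction_eq_zero h.2, fun θ hθ => ?_⟩
  have hne : fderiv ℝ (areaDensity f ν) p (Real.cos θ, Real.sin θ) ≠ 0 := fun h => hθ.2 ⟨hθ.1, h⟩
  have hS := tendsto_polarPoint p θ (hf.isOpen.mem_nhds hp)
  constructor
  · filter_upwards [hS, eventually_ne_polarPoint hl h0 hne] with r h1 h2
    exact (hf.mem_regularSet_iff h1).2 h2
  · refine ⟨_, ((tendsto_div_polarPoint hm hm0 θ).div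
      (tendsto_div_polarPoint hl h0 θ) hne).congr' ?_⟩
    filter_upwards [hS, self_mem_nhdsWithin] with r h1 hr
    rw [hf.gaussianCurvature_eq h1]
    exact div_div_div_cancel_right₀ (ne_of_gt hr) _ _

/-- If the area density of the Gauss map of a front vanishes at `p` together with its derivative in
the null direction, then the Gauss map of the focal surface is singular at `p`. -/
theorem IsFront.areaDensity_focalNormal_eq_zero (hf : IsFront S f ν) (hp : p ∈ S) {s : ℝ}
    (hs : s * s = 1) (hps : p ∈ radiusDomain S f ν s) (h0 : areaDensity f ν p = 0)
    {η : Plane} (hη : η ≠ 0) (hη0 : fderiv ℝ f p η = 0) (hm0 : areaDensity ν ν p = 0)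
    (hmη : fderiv ℝ (areaDensity ν ν) p η = 0) {U : Set Plane} {n : Plane → Space} (hpU : p ∈ U)
    (hn : IsFrontal U (focalSurface f ν) n)
    (hd : fderiv ℝ (areaDensity (focalSurface f ν) n) p ≠ 0) : areaDensity n n p = 0 := by
  have hνη := hf.fderiv_normal_ne_zero hp hη hη0
  obtain ⟨ξ, hξ, hξ0⟩ : ∃ ξ : Plane, ξ ≠ 0 ∧ fderiv ℝ ν p ξ = 0 := by
    have h1 := (isSingularPoint_iff_of_inner_eq_zero (hf.unit_normal p hp)
      (hf.inner_normal_fderiv hp)).2 hm0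
    rw [IsSingularPoint, injective_iff_map_eq_zero] at h1
    push Not at h1
    obtain ⟨ξ, a, b⟩ := h1
    exact ⟨ξ, b, a⟩
  have hfξ : fderiv ℝ f p ξ ≠ 0 := fun h => hf.fderiv_normal_ne_zero hp hξ h hξ0
  have hdet : det2 ξ η ≠ 0 := by
    intro h
    obtain ⟨t, rfl⟩ := exists_smul_of_det2_eq_zero hξ h
    exact hνη (by rw [map_smul, hξ0, smul_zero])
  have hρ0 : smallRadius f ν s p = 0 := by rw [smallRadius, h0, zero_div]
  have hA : focalTangent f ν s ξ p = fderiv ℝ f p ξ := by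
    rw [focalTangent, hρ0, zero_smul, add_zero]
  have hAsm := hf.contDiffAt_focalTangent hs hps ξ
  have hdom := hf.radiusDomain_mem_nhds hps
  have hU := hn.isOpen.mem_nhds hpU
  -- The normal `n` is arbitrary and is determined up to sign only at regular points of `Ĉ`;
  -- non-degeneracy carries its orthogonality relations over to `p`.
  have hev : ∀ᶠ q in 𝓝 p, areaDensity (focalSurface f ν) n q ≠ 0 →
      inner ℝ (n q) (ν q) = 0 ∧ inner ℝ (n q) (focalTangent f ν s ξ q) = 0 := by
    filter_upwards [hdom, hU, hAsm.continuousAt.eventually_ne (by rw [hA]; exact hfξ)]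
      with q h1 h2 h3 h4
    exact hf.orthogonal_of_regular hs h1 hn h2 h3 h4
  have hperp : (fun q => inner ℝ (n q) (ν q)) =ᶠ[𝓝 p] fun _ => (0 : ℝ) := by
    refine hn.eventually_eq_zero_of_nondegenerate hpU hd ?_ (hev.mono fun q h h' => (h h').1)
    filter_upwards [hdom, hU] with q h1 h2
    exact (hn.contDiffAt_normal h2).continuousAt.inner (𝕜 := ℝ)
      (hf.contDiffAt_normal h1.1).continuousAt
  have hperp' : (fun q => inner ℝ (n q) (focalTangent f ν s ξ q)) =ᶠ[𝓝 p] fun _ => (0 : ℝ) := by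
    refine hn.eventually_eq_zero_of_nondegenerate hpU hd ?_ (hev.mono fun q h h' => (h h').2)
    filter_upwards [hdom, hU] with q h1 h2
    exact (hn.contDiffAt_normal h2).continuousAt.inner (𝕜 := ℝ)
      (hf.contDiffAt_focalTangent hs h1 ξ).continuousAt
  have hnν : inner ℝ (n p) (ν p) = 0 := hperp.self_of_nhds
  have hnf : inner ℝ (n p) (fderiv ℝ f p ξ) = 0 := by
    rw [← hA]
    exact hperp'.self_of_nhds
  have hsym : inner ℝ (fderiv ℝ f p ξ) (fderiv ℝ ν p η) = 0 := by
    rw [hf.inner_fderiv_comm hp, hη0, inner_zero_left]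
  have hbasis : det3 (fderiv ℝ f p ξ) (fderiv ℝ ν p η) (ν p) ≠ 0 := by
    intro h
    have h1 := det3_mul_det3 (fderiv ℝ f p ξ) (fderiv ℝ ν p η) (ν p)
      (fderiv ℝ f p ξ) (fderiv ℝ ν p η) (ν p)
    rw [h, hsym, hf.orthogonal p hp, hf.inner_normal_fderiv hp,
      inner_unit_self (hf.unit_normal p hp)] at h1
    have h2 : inner ℝ (fderiv ℝ f p ξ) (fderiv ℝ f p ξ)
        * inner ℝ (fderiv ℝ ν p η) (fderiv ℝ ν p η) = 0 := by linarith
    rcases mul_eq_zero.1 h2 with h3 | h3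
    · exact hfξ (inner_self_eq_zero.1 h3)
    · exact hνη (inner_self_eq_zero.1 h3)
  -- Differentiating `det(ν_ξ, ν_η, ν)`, a constant multiple of `μ`, along `η` leaves only
  -- `det(ν_ξη, ν_η, ν)`, because `ν_ξ(p) = 0`; it vanishes by `dμ(η) = 0`.
  have hνξη : inner ℝ (fderiv ℝ f p ξ) (fderiv ℝ (fun q => fderiv ℝ ν q ξ) p η) = 0 := by
    have h1 : (fun q => det3 (fderiv ℝ ν q ξ) (fderiv ℝ ν q η) (ν q))
        = fun q => det2 ξ η * areaDensity ν ν q := by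
      funext q
      exact det3_apply_apply _ _ _ _
    have h2 := fderiv_det3 (hf.differentiableAt_fderiv_normal hp ξ)
      (hf.differentiableAt_fderiv_normal hp η) (hf.differentiableAt_normal hp) η
    rw [h1, fderiv_const_mul
      ((hf.contDiffAt_areaDensity_normal hp).differentiableAt (by simp)), smul_apply,
      hmη, hξ0] at h2
    have h3 : det3 (fderiv ℝ (fun q => fderiv ℝ ν q ξ) p η) (fderiv ℝ ν p η) (ν p) = 0 := by
      simpa [det3_eq] using h2.symm
    have h4 := det3_mul_det3 (fderiv ℝ (fun q => fderiv ℝ ν q ξ) p η) (fderiv ℝ ν p η) (ν p)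
      (fderiv ℝ f p ξ) (fderiv ℝ ν p η) (ν p)
    rw [h3, real_inner_comm (fderiv ℝ f p ξ) (fderiv ℝ ν p η), hsym,
      real_inner_comm (fderiv ℝ f p ξ) (ν p), hf.orthogonal p hp, hf.inner_normal_fderiv hp,
      inner_unit_self (hf.unit_normal p hp)] at h4
    have h5 : inner ℝ (fderiv ℝ (fun q => fderiv ℝ ν q ξ) p η) (fderiv ℝ f p ξ)
        * inner ℝ (fderiv ℝ ν p η) (fderiv ℝ ν p η) = 0 := by linarith
    rw [real_inner_comm]
    exact (mul_eq_zero.1 h5).resolve_right fun h => hνη (inner_self_eq_zero.1 h)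
  -- Differentiate the symmetry `⟨f_ξ, ν_η⟩ = ⟨f_η, ν_ξ⟩` along `ξ`; the right side contributes
  -- nothing since `f_η` and `ν_ξ` vanish at `p`.
  have hfξξ : inner ℝ (fderiv ℝ (fun q => fderiv ℝ f q ξ) p ξ) (fderiv ℝ ν p η) = 0 := by
    have h1 : (fun q => inner ℝ (fderiv ℝ f q ξ) (fderiv ℝ ν q η)
        - inner ℝ (fderiv ℝ f q η) (fderiv ℝ ν q ξ)) =ᶠ[𝓝 p] fun _ => (0 : ℝ) := by
      filter_upwards [hf.isOpen.mem_nhds hp] with q hq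
      rw [hf.inner_fderiv_comm hq, sub_self]
    have d1 := hf.differentiableAt_fderiv hp ξ
    have d2 := hf.differentiableAt_fderiv hp η
    have d3 := hf.differentiableAt_fderiv_normal hp ξ
    have d4 := hf.differentiableAt_fderiv_normal hp η
    have h2 := congrArg (fun L : Plane →L[ℝ] ℝ => L ξ) (h1.fderiv_eq (𝕜 := ℝ))
    simp only [fderiv_fun_sub (d1.inner ℝ d4) (d2.inner ℝ d3), sub_apply,
      fderiv_inner_apply ℝ d1 d4, fderiv_inner_apply ℝ d2 d3] at h2
    rw [fderiv_fderiv_comm (hf.contDiffAt_normal hp) η ξ, hνξη, hξ0, hη0] at h2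
    simpa using h2
  have hnη : ∃ t : ℝ, n p = t • fderiv ℝ ν p η := by
    have h1 : inner ℝ (fderiv ℝ ν p η) (fderiv ℝ ν p η) ≠ 0 :=
      fun h => hνη (inner_self_eq_zero.1 h)
    refine ⟨inner ℝ (n p) (fderiv ℝ ν p η) / inner ℝ (fderiv ℝ ν p η) (fderiv ℝ ν p η),
      sub_eq_zero.1 (eq_zero_of_inner_eq_zero hbasis ?_ ?_ ?_)⟩
    · rw [inner_sub_left, real_inner_smul_left, hnf,
        real_inner_comm (fderiv ℝ f p ξ) (fderiv ℝ ν p η), hsym]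
      simp
    · rw [inner_sub_left, real_inner_smul_left, div_mul_cancel₀ _ h1, sub_self]
    · rw [inner_sub_left, real_inner_smul_left, hnν, hf.inner_normal_fderiv hp]
      simp
  obtain ⟨t, ht⟩ := hnη
  -- Tested on the basis `f_ξ`, `ν_η`, `ν`: the first and last products come from differentiating
  -- the relations `n ⟂ A` and `n ⟂ ν`, the middle one from `|n| = 1` and `n(p) ∥ ν_η`.
  have hnξ : fderiv ℝ n p ξ = 0 := by
    have dn := hn.differentiableAt_normal hpU
    refine eq_zero_of_inner_eq_zero hbasis ?_ ?_ ?_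
    · have dρ := (hf.contDiffAt_smallRadius hs hps).differentiableAt (by simp)
      have d1 := hf.differentiableAt_fderiv hp ξ
      have d2 := hf.differentiableAt_fderiv_normal hp ξ
      have h1 : fderiv ℝ (focalTangent f ν s ξ) p ξ
          = fderiv ℝ (fun q => fderiv ℝ f q ξ) p ξ := by
        unfold focalTangent
        rw [fderiv_fun_add d1 (dρ.fun_smul d2), fderiv_fun_smul dρ d2]
        simp [hρ0, hξ0]
      have h2 := fderiv_inner_apply ℝ dn (hAsm.differentiableAt (by simp)) ξ
      rw [hperp'.fderiv_eq, h1, ht, hA, real_inner_smul_left,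
        real_inner_comm (fderiv ℝ (fun q => fderiv ℝ f q ξ) p ξ), hfξξ] at h2
      simpa using h2.symm
    · have h1 := hn.inner_normal_fderiv hpU ξ
      rw [ht, real_inner_smul_right] at h1
      refine (mul_eq_zero.1 h1).resolve_left fun h => ?_
      have h2 := hn.unit_normal p hpU
      rw [ht, h] at h2
      simp at h2
    · have h1 := fderiv_inner_apply ℝ dn (hf.differentiableAt_normal hp) ξ
      rw [hperp.fderiv_eq, hξ0] at h1
      simpa using h1.symm
  have h1 := det3_apply_apply (fderiv ℝ n p) (n p) ξ η
  rw [hnξ] at h1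
  have h2 : det2 ξ η * areaDensity n n p = 0 := by
    rw [areaDensity, partialU, partialV, ← h1, det3_eq]
    simp
  exact (mul_eq_zero.1 h2).resolve_left hdet

end

end FrontGeometry

theorem corollary4p15 (S : Set FrontGeometry.Plane)
    (f ν : FrontGeometry.Plane → FrontGeometry.Space) (hf : FrontGeometry.IsFront S f ν)
    (p : FrontGeometry.Plane) (hp : p ∈ S) (hp2 : FrontGeometry.IsSecondKind S f ν p)
    (hK : FrontGeometry.IsBoundedNear (FrontGeometry.regularSet S f)
          (FrontGeometry.gaussianCurvature f ν) p ∨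
        FrontGeometry.IsRationallyContinuous (FrontGeometry.regularSet S f)
          (FrontGeometry.gaussianCurvature f ν) p) :
    (∃ (U : Set FrontGeometry.Plane) (n : FrontGeometry.Plane → FrontGeometry.Space),
        p ∈ U ∧ U ⊆ S ∧ FrontGeometry.IsFrontal U (FrontGeometry.focalSurface f ν) n) ∧
      ∀ (U : Set FrontGeometry.Plane) (n : FrontGeometry.Plane → FrontGeometry.Space),
        p ∈ U → U ⊆ S → FrontGeometry.IsFrontal U (FrontGeometry.focalSurface f ν) n →
          FrontGeometry.IsNondegenerateSingularPoint (FrontGeometry.focalSurface f ν) n p →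
            FrontGeometry.IsRationallyBounded
              (FrontGeometry.regularSet U (FrontGeometry.focalSurface f ν))
              (FrontGeometry.gaussianCurvature (FrontGeometry.focalSurface f ν) n) p := by
  have hF := hf.toIsFrontal
  have h0 := (hF.isSingularPoint_iff hp).1 hp2.1.1
  obtain ⟨η, hη, hη0, hlη⟩ := hp2.exists_null hF hp
  obtain ⟨ξ, hξ⟩ := hF.exists_fderiv_ne_zero hp hp2.1.2
  have hh := hf.meanDensity_ne_zero hp hξ hη hη0
  -- The sign of `h(p)` selects the root of the quadratic that vanishes on the singular curve.
  obtain ⟨s, hs, hsh⟩ : ∃ s : ℝ, s * s = 1 ∧ 0 < s * FrontGeometry.meanDensity f ν p := by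
    rcases lt_or_gt_of_ne hh with h | h
    · exact ⟨-1, by norm_num, by linarith⟩
    · exact ⟨1, by norm_num, by linarith⟩
  have hps : p ∈ FrontGeometry.radiusDomain S f ν s := by
    refine ⟨hp, hsh, ?_⟩
    rw [FrontGeometry.discriminantDensity, h0, zero_mul, sub_zero]
    positivity
  -- The radius vanishes at `p`, so there the vector is just `df(ξ)`.
  have hA : FrontGeometry.focalTangent f ν s ξ p ≠ 0 := by
    rwa [FrontGeometry.focalTangent, FrontGeometry.smallRadius, h0, zero_div, zero_smul, add_zero]
  refine ⟨⟨_, _, Set.mem_ofPred.2 ⟨hps, hA⟩, fun q hq => hq.1.1,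
    hF.isFrontal_focalSurface hs ξ⟩, ?_⟩
  intro U n hpU _ hn hnd
  obtain ⟨B, T, hT, hB⟩ := hF.exists_abs_le_of_gaussianCurvature hp h0 hp2.1.2 hK
  obtain ⟨hm0, hm⟩ := hF.areaDensity_normal_eq_zero hp h0 hT hB
  exact hn.isRationallyBounded_gaussianCurvature hpU hnd
    (hf.areaDensity_focalNormal_eq_zero hp hs hps h0 hη hη0 hm0 (hm η hlη) hpU hn hnd.2)
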